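/- Let $k$ be an algebraically closed field of characteristic zero, and consider $$f_{Q_{18}} = x^8+y^3+xz^2 \in k[x,y,z], \qquad f_{E_{30}} = u^8w-v^3-w^2 \in k[u,v,w],$$ with the $\mathbb{Q}$-gradings $|x|=\tfrac14,\ |y|=\tfrac23,\ |z|=\tfrac78$ and $|u|=\tfrac18,\ |v|=\tfrac23,\ |w|=1$. A quasi-homogeneous polynomial $f$ in variables of positive rational degree is called a potential if its Jacobian ring (the quotient by the ideal of all partial derivatives) is a nonzero finite-dimensional $k$-vector space. For $f\in k[x_1,\dots,x_m]$ and $g\in k[y_1,\dots,y_n]$ put $T=k[x_1,\dots,x_m,y_1,\dots,y_n]$. A matrix factorization $Q$ of $f-g$ is a finitely generated free, $\mathbb{Q}$-graded, $\mathbb{Z}/2$-graded $T$-module with an odd, quasi-homogeneous endomorphism $d_Q$ such that $d_Q^2=(f-g)\cdot\mathrm{Id}$. Its left quantum dimension is the residue $$\operatorname{res}\left(\frac{\operatorname{str}\big(\partial_{x_1}d_Q\cdots\partial_{x_m}d_Q\,\partial_{y_1}d_Q\cdots\partial_{y_n}d_Q\big)\,\mathrm{d}x_1\wedge\cdots\wedge\mathrm{d}x_m}{\partial_{x_1}f,\dots,\partial_{x_m}f}\right),$$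 taken over $k[y_1,\dots,y_n]$, where $d_Q$ is written as a matrix in a homogeneous basis and $\operatorname{str}$ is the supertrace; its right quantum dimension is the residue of the same supertrace with $\mathrm{d}y_1\wedge\cdots\wedge\mathrm{d}y_n$ in the numerator and $\partial_{y_1}g,\dots,\partial_{y_n}g$ in the denominator, over $k[x_1,\dots,x_m]$. (For polynomials $f_1,\dots,f_q$ in $x_1,\dots,x_q$ over a commutative ring and a square matrix $M$ with $M(f_1,\dots,f_q)^{t}=(x_1^{e_1},\dots,x_q^{e_q})^{t}$, all $e_i\ge 1$, the residue of $h\,\mathrm{d}x_1\wedge\cdots\wedge\mathrm{d}x_q$ over $f_1,\dots,f_q$ is the coefficient of $x_1^{e_1-1}\cdots x_q^{e_q-1}$ in $h\det M$; it does not depend on $M$.) Two potentials $f$ and $g$ are orbifold equivalent if $f-g$ has a matrix factorization with nonzero left and right quantum dimensions. Then $f_{Q_{18}}$ and $f_{E_{30}}$ are potentials, and they are orbifold equivalent. Moreover, there is a matrix factorization of $f_{Q_{18}}-f_{E_{30}}$ of rank $8$ with nonzero left and right quantum dimensions. -/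

import Mathlib

namespace LandauGinzburg

open MvPolynomial

/-! ### Potentials -/

section Potentials

/-- The Jacobian ideal: the ideal generated by all partial derivatives of `f`. -/
noncomputable def jacobianIdeal {σ k : Type*} [Field k] (f : MvPolynomial σ k) : Ideal (MvPolynomial σ k) :=
  Ideal.span (Set.range fun i => pderiv i f)

/-- `f` is a potential in the polynomial ring whose variable `i` has the positive rational degree
`w i`: it is quasi-homogeneous, and its Jacobian ring is a nonzero finite-dimensional `k`-vector
space. -/
structure IsPotential {σ k : Type*} [Field k] (w : σ → ℚ) (f : MvPolynomial σ k) : Prop where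
  weight_pos : ∀ i, 0 < w i
  quasiHomogeneous : ∃ D : ℚ, IsWeightedHomogeneous w f D
  jacobian_nontrivial : Nontrivial (MvPolynomial σ k ⧸ jacobianIdeal f)
  jacobian_finite : Module.Finite k (MvPolynomial σ k ⧸ jacobianIdeal f)

end Potentials

/-! ### Multivariate residues -/

section Residue

variable {σ A : Type*} [CommRing A]

theorem mem_span_pow_iff (s : Set σ) (e : σ → ℕ) (p : MvPolynomial σ A) :
    p ∈ Ideal.span ((fun i => (X i : MvPolynomial σ A) ^ e i) '' s) ↔
      ∀ c ∈ p.support, ∃ i ∈ s, e i ≤ c i := by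
  have h : (fun i => (X i : MvPolynomial σ A) ^ e i) '' s =
      (fun c => monomial c (1 : A)) '' ((fun i => Finsupp.single i (e i)) '' s) := by
    rw [Set.image_image]
    refine Set.image_congr fun i _ => ?_
    rw [X_pow_eq_monomial]
  rw [h, mem_ideal_span_monomial_image]
  simp [Finsupp.single_le_iff]

theorem mem_span_of_mul_pow_mem [DecidableEq σ] (i₀ : σ) (e : σ → ℕ) (p : MvPolynomial σ A)
    (h : p * X i₀ ^ e i₀ ∈
      Ideal.span ((fun i => (X i : MvPolynomial σ A) ^ e i) '' {i | i ≠ i₀})) :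
    p ∈ Ideal.span ((fun i => (X i : MvPolynomial σ A) ^ e i) '' {i | i ≠ i₀}) := by
  rw [mem_span_pow_iff] at h ⊢
  intro c hc
  obtain ⟨i, hi, hle⟩ := h (c + Finsupp.single i₀ (e i₀)) (by
    rw [X_pow_eq_monomial, mem_support_iff, coeff_mul_monomial, mul_one]
    exact mem_support_iff.1 hc)
  refine ⟨i, hi, ?_⟩
  have hne : i ≠ i₀ := hi
  simpa [Finsupp.single_apply, hne.symm] using hle

variable [Fintype σ]

/-- The square matrix `M` transforms the tuple `f` into the tuple `(X i ^ e i)` of positive powers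
of the variables. -/
def IsTransform (f : σ → MvPolynomial σ A) (e : σ → ℕ)
    (M : Matrix σ σ (MvPolynomial σ A)) : Prop :=
  (∀ i, 0 < e i) ∧ Matrix.mulVec M f = fun i => X i ^ e i

/-- The coefficient of `∏ i, X i ^ (e i - 1)` in `p`; this is the residue symbol of
`p dx₁ ∧ ⋯ ∧ dx_q` over `x₁ ^ e₁, …, x_q ^ e_q`. -/
noncomputable def topCoeff (e : σ → ℕ) (p : MvPolynomial σ A) : A :=
  coeff (Finsupp.equivFunOnFinite.symm fun i => e i - 1) p

open Classical in
/-- The residue symbol `res (g dx₁ ∧ ⋯ ∧ dx_q / f₁, …, f_q)` over the base ring `A`. By the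
transformation rule it equals `res (g det(M) dx₁ ∧ ⋯ ∧ dx_q / x₁ ^ e₁, …, x_q ^ e_q)`
for any matrix `M` with `M f = (x₁ ^ e₁, …, x_q ^ e_q)`, and the latter residue is
a coefficient of `g det(M)`. The value does not depend on the choice of `M`, see `residue_eq`.
(If there is no such `M`, that is, if no power of `(x₁, …, x_q)` lies in `(f₁, …, f_q)`, the
value is `0` by convention.) -/
noncomputable def residue (f : σ → MvPolynomial σ A) (g : MvPolynomial σ A) : A :=
  if h : ∃ eM : (σ → ℕ) × Matrix σ σ (MvPolynomial σ A), IsTransform f eM.1 eM.2 then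
    topCoeff h.choose.1 (g * h.choose.2.det)
  else 0

theorem topCoeff_eq_zero {e : σ → ℕ} (he : ∀ i, 0 < e i) {s : Set σ} {p : MvPolynomial σ A}
    (h : p ∈ Ideal.span ((fun i => (X i : MvPolynomial σ A) ^ e i) '' s)) :
    topCoeff e p = 0 := by
  by_contra hne
  obtain ⟨i, -, hi⟩ := (mem_span_pow_iff s e p).1 h _ (mem_support_iff.2 hne)
  have := he i
  simp at hi
  omega

variable [DecidableEq σ]

theorem det_mem_span {f : σ → MvPolynomial σ A} {e : σ → ℕ} {i₀ : σ}
    {M N : Matrix σ σ (MvPolynomial σ A)} (hM : Matrix.mulVec M f = fun i => X i ^ e i)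
    (hN : ∀ i, i ≠ i₀ → Matrix.mulVec N f i = X i ^ e i) (h0 : Matrix.mulVec N f i₀ = 0) :
    N.det ∈ Ideal.span ((fun i => (X i : MvPolynomial σ A) ^ e i) '' {i | i ≠ i₀}) := by
  apply mem_span_of_mul_pow_mem
  have key : ∀ j, N.det * f j ∈
      Ideal.span ((fun i => (X i : MvPolynomial σ A) ^ e i) '' {i | i ≠ i₀}) := by
    intro j
    have h1 : Matrix.mulVec N.adjugate (Matrix.mulVec N f) = N.det • f := by
      rw [Matrix.mulVec_mulVec, Matrix.adjugate_mul, Matrix.smul_mulVec, Matrix.one_mulVec]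
    have h2 := congrFun h1 j
    rw [Pi.smul_apply, smul_eq_mul] at h2
    rw [← h2]
    refine Ideal.sum_mem _ fun i _ => Ideal.mul_mem_left _ _ ?_
    by_cases hi : i = i₀
    · rw [hi, h0]
      exact Ideal.zero_mem _
    · rw [hN i hi]
      exact Ideal.subset_span ⟨i, hi, rfl⟩
  have h3 := congrFun hM i₀
  rw [← h3, Matrix.mulVec, dotProduct, Finset.mul_sum]
  refine Ideal.sum_mem _ fun j _ => ?_
  rw [mul_left_comm]
  exact Ideal.mul_mem_left _ _ (key j)

theorem topCoeff_det_congr {f : σ → MvPolynomial σ A} {e : σ → ℕ}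
    {M N : Matrix σ σ (MvPolynomial σ A)} (hM : IsTransform f e M) (hN : IsTransform f e N)
    (g : MvPolynomial σ A) : topCoeff e (g * M.det) = topCoeff e (g * N.det) := by
  let K : Finset σ → Matrix σ σ (MvPolynomial σ A) := fun s i => if i ∈ s then N i else M i
  have hK : ∀ s i, Matrix.mulVec (K s) f i = X i ^ e i := by
    intro s i
    by_cases hi : i ∈ s
    · have := congrFun hN.2 i
      simpa [Matrix.mulVec, K, hi] using this
    · have := congrFun hM.2 i
      simpa [Matrix.mulVec, K, hi] using this
  have step : ∀ s, topCoeff e (g * (K s).det) = topCoeff e (g * M.det) := by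
    intro s
    induction s using Finset.induction_on with
    | empty => rfl
    | insert a s ha ih =>
      rw [← ih]
      have h1 : K (insert a s) = (K s).updateRow a (K s a + (N a - M a)) := by
        funext i
        by_cases hi : i = a
        · subst hi
          rw [Matrix.updateRow_self]
          simp [K, ha]
        · rw [Matrix.updateRow_ne hi]
          simp [K, hi]
      have h2 : (K (insert a s)).det =
          (K s).det + ((K s).updateRow a (N a - M a)).det := by
        rw [h1, Matrix.det_updateRow_add, Matrix.updateRow_eq_self]
      have h3 : ((K s).updateRow a (N a - M a)).det ∈
          Ideal.span ((fun i => (X i : MvPolynomial σ A) ^ e i) '' {i | i ≠ a}) := by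
        refine det_mem_span hM.2 (fun i hi => ?_) ?_
        · rw [← hK s i]
          simp [Matrix.mulVec, hi]
        · have e1 := congrFun hN.2 a
          have e2 := congrFun hM.2 a
          simp only [Matrix.mulVec] at e1 e2
          simp only [Matrix.mulVec, Matrix.updateRow_self]
          rw [sub_dotProduct, e1, e2, sub_self]
      have h4 : topCoeff e (g * ((K s).updateRow a (N a - M a)).det) = 0 :=
        topCoeff_eq_zero hM.1 (Ideal.mul_mem_left _ _ h3)
      rw [h2, mul_add]
      rw [topCoeff, coeff_add]
      rw [topCoeff] at h4
      rw [h4, add_zero, topCoeff]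
  have hlast : K Finset.univ = N := by
    ext i j : 2
    simp [K]
  rw [← step Finset.univ, hlast]

theorem isTransform_scale {f : σ → MvPolynomial σ A} {e : σ → ℕ}
    {M : Matrix σ σ (MvPolynomial σ A)} (hM : IsTransform f e M) (c : σ → ℕ) :
    IsTransform f (fun i => c i + e i) (Matrix.diagonal (fun i => X i ^ c i) * M) := by
  refine ⟨fun i => Nat.add_pos_right _ (hM.1 i), ?_⟩
  rw [← Matrix.mulVec_mulVec, hM.2]
  funext i
  rw [Matrix.mulVec_diagonal, pow_add]

theorem topCoeff_scale {e : σ → ℕ} (he : ∀ i, 0 < e i) (c : σ → ℕ)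
    (g : MvPolynomial σ A) (M : Matrix σ σ (MvPolynomial σ A)) :
    topCoeff (fun i => c i + e i) (g * (Matrix.diagonal (fun i => X i ^ c i) * M).det) =
      topCoeff e (g * M.det) := by
  have h1 : (∏ i, (X i : MvPolynomial σ A) ^ c i) =
      monomial (Finsupp.equivFunOnFinite.symm c) 1 := by
    rw [monomial_eq, C_1, one_mul, Finsupp.prod_fintype _ _ (fun i => pow_zero _)]
    rfl
  have h2 : (Finsupp.equivFunOnFinite.symm fun i => c i + e i - 1) =
      Finsupp.equivFunOnFinite.symm c + Finsupp.equivFunOnFinite.symm fun i => e i - 1 := by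
    ext i
    have := he i
    simp
    omega
  rw [Matrix.det_mul, Matrix.det_diagonal, h1, mul_left_comm, topCoeff, h2, coeff_monomial_mul,
    one_mul, topCoeff]

/-- The residue symbol can be computed from any admissible matrix. -/
theorem residue_eq {f : σ → MvPolynomial σ A} {e : σ → ℕ}
    {M : Matrix σ σ (MvPolynomial σ A)} (hM : IsTransform f e M) (g : MvPolynomial σ A) :
    residue f g = topCoeff e (g * M.det) := by
  have h : ∃ eM : (σ → ℕ) × Matrix σ σ (MvPolynomial σ A), IsTransform f eM.1 eM.2 :=
    ⟨(e, M), hM⟩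
  have h0 := h.choose_spec
  have hr : residue f g = topCoeff h.choose.1 (g * h.choose.2.det) := by
    rw [residue, dif_pos h]
    congr!
  rw [hr, ← topCoeff_scale h0.1 e, ← topCoeff_scale hM.1 h.choose.1]
  have t1 := isTransform_scale h0 e
  have t2 := isTransform_scale hM h.choose.1
  have hc : (fun i => h.choose.1 i + e i) = fun i => e i + h.choose.1 i := by
    funext i
    exact add_comm _ _
  rw [hc] at t2 ⊢
  exact topCoeff_det_congr t1 t2 g

end Residue

/-! ### Matrix factorizations -/

/-- A matrix factorization of `W` over the polynomial ring `k[X i | i : σ]` in which the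
variable `X i` has degree `w i`. The underlying finitely generated free graded supergraded module
is given by a basis of quasi-homogeneous vectors, the even ones indexed by `Fin evenRank`, the odd
ones by `Fin oddRank`, and `d` is the matrix of the odd homogeneous twisted differential in this
basis (its `j`-th column is the image of the `j`-th basis vector). -/
structure MatrixFactorization {σ k : Type*} [Field k] (w : σ → ℚ) (W : MvPolynomial σ k) where
  evenRank : ℕ
  oddRank : ℕ
  /-- The degree of each basis vector. -/
  genDeg : Fin evenRank ⊕ Fin oddRank → ℚ
  d : Matrix (Fin evenRank ⊕ Fin oddRank) (Fin evenRank ⊕ Fin oddRank) (MvPolynomial σ k)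
  /-- The degree of the differential. -/
  degree : ℚ
  even_even : ∀ i j, d (Sum.inl i) (Sum.inl j) = 0
  odd_odd : ∀ i j, d (Sum.inr i) (Sum.inr j) = 0
  homogeneous : ∀ i j, IsWeightedHomogeneous w (d i j) (genDeg j - genDeg i + degree)
  sq : d * d = W • (1 : Matrix (Fin evenRank ⊕ Fin oddRank) (Fin evenRank ⊕ Fin oddRank)
    (MvPolynomial σ k))

/-- The rank of the underlying free module. -/
def MatrixFactorization.rank {σ k : Type*} [Field k] {w : σ → ℚ} {W : MvPolynomial σ k}
    (Q : MatrixFactorization w W) : ℕ :=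
  Q.evenRank + Q.oddRank

/-- The supertrace: the trace on the even part minus the trace on the odd part. -/
def supertrace {p q : ℕ} {T : Type*} [CommRing T]
    (A : Matrix (Fin p ⊕ Fin q) (Fin p ⊕ Fin q) T) : T :=
  (∑ i, A (Sum.inl i) (Sum.inl i)) - ∑ i, A (Sum.inr i) (Sum.inr i)

/-! ### Quantum dimensions and orbifold equivalence -/

section Orbifold

variable {k : Type*} [Field k] {m n : ℕ}

/-- `f ⊗ 1 - 1 ⊗ g` in `k[x₁, …, x_m] ⊗ k[y₁, …, y_n] = k[x₁, …, x_m, y₁, …, y_n]`. -/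
noncomputable def difference (f : MvPolynomial (Fin m) k) (g : MvPolynomial (Fin n) k) :
    MvPolynomial (Fin m ⊕ Fin n) k :=
  rename Sum.inl f - rename Sum.inr g

/-- The polynomial `str (∂_{x₁} Q ⋯ ∂_{x_m} Q ∂_{y₁} Q ⋯ ∂_{y_n} Q)`, where `∂ Q` is the entrywise
derivative of the differential of `Q`. -/
noncomputable def qdimNumerator {w : Fin m ⊕ Fin n → ℚ} {W : MvPolynomial (Fin m ⊕ Fin n) k}
    (Q : MatrixFactorization w W) : MvPolynomial (Fin m ⊕ Fin n) k :=
  supertrace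
    ((List.ofFn fun i : Fin m => Q.d.map (pderiv (Sum.inl i))).prod *
      (List.ofFn fun j : Fin n => Q.d.map (pderiv (Sum.inr j))).prod)

/-- The left quantum dimension of a matrix factorization of `f - g`: the residue, in the variables
`x₁, …, x_m` and over `k[y₁, …, y_n]`, with respect to the partial derivatives of `f`. -/
noncomputable def leftQdim {w : Fin m ⊕ Fin n → ℚ} (f : MvPolynomial (Fin m) k)
    (g : MvPolynomial (Fin n) k) (Q : MatrixFactorization w (difference f g)) :
    MvPolynomial (Fin n) k :=
  residue (fun i => map C (pderiv i f)) (sumAlgEquiv k (Fin m) (Fin n) (qdimNumerator Q))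

/-- The right quantum dimension of a matrix factorization of `f - g`: the residue, in the variables
`y₁, …, y_n` and over `k[x₁, …, x_m]`, with respect to the partial derivatives of `g`. -/
noncomputable def rightQdim {w : Fin m ⊕ Fin n → ℚ} (f : MvPolynomial (Fin m) k)
    (g : MvPolynomial (Fin n) k) (Q : MatrixFactorization w (difference f g)) :
    MvPolynomial (Fin m) k :=
  residue (fun j => map C (pderiv j g))
    (sumAlgEquiv k (Fin n) (Fin m) (rename Sum.swap (qdimNumerator Q)))

/-- Two potentials `f` and `g`, with variables of degrees `wf` and `wg`, are orbifold
equivalent. -/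
def OrbifoldEquivalent (wf : Fin m → ℚ) (f : MvPolynomial (Fin m) k)
    (wg : Fin n → ℚ) (g : MvPolynomial (Fin n) k) : Prop :=
  IsPotential wf f ∧ IsPotential wg g ∧
    ∃ Q : MatrixFactorization (Sum.elim wf wg) (difference f g),
      leftQdim f g Q ≠ 0 ∧ rightQdim f g Q ≠ 0

end Orbifold

/-! ### The two potentials -/

/-- The degrees `|x| = 1/4`, `|y| = 2/3`, `|z| = 7/8`. -/
def weightQ18 : Fin 3 → ℚ := ![1 / 4, 2 / 3, 7 / 8]

/-- The degrees `|u| = 1/8`, `|v| = 2/3`, `|w| = 1`. -/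
def weightE30 : Fin 3 → ℚ := ![1 / 8, 2 / 3, 1]

/-- `x ^ 8 + y ^ 3 + x z ^ 2` in the variables `x = X 0`, `y = X 1`, `z = X 2`. -/
noncomputable def fQ18 (k : Type*) [Field k] : MvPolynomial (Fin 3) k :=
  X 0 ^ 8 + X 1 ^ 3 + X 0 * X 2 ^ 2

/-- `u ^ 8 w - v ^ 3 - w ^ 2` in the variables `u = X 0`, `v = X 1`, `w = X 2`. -/
noncomputable def fE30 (k : Type*) [Field k] : MvPolynomial (Fin 3) k :=
  X 0 ^ 8 * X 2 - X 1 ^ 3 - X 2 ^ 2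

end LandauGinzburg

namespace LandauGinzburg

open MvPolynomial

/-! ### Koszul matrix factorizations with three factors -/

section Koszul

variable {R S : Type*} [CommRing R] [CommRing S]

/-! The difference of the potentials is a sum of three products, so a Koszul matrix factorization of
rank 8 is available. Completing the square turns `w² - u⁸w` into `(w - u⁸/2)² - u¹⁶/4`. If `a⁸ =
1/2`, then `x + a²u²` divides `x⁸ - u¹⁶/4`. Replacing `xz²` by `(x + a²u²)z²` creates an excess
`a²u²z²`, which makes the square a difference of squares `(w - a⁸u⁸)² - (auz)²`. The remaining `y³ +
v³` is divisible by `y + v`.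

The quantum dimensions are computable because a Koszul matrix is linear in its factors. Each partial
derivative of it is again Koszul, hence lies in the span of six Clifford generators. The supertrace
of a product of six such elements is, up to sign, the 6×6 determinant of their coefficients
(`supertrace_koszul_six`). This gives the numerator in `qdimNumerator_factorization`. In either
residue only one monomial of the numerator survives, so both dimensions are explicit constants: `2a`
on the left and `4a¹⁵` on the right. -/

/-- The component from odd to even of the Koszul matrix of `p₀ q₀ + p₁ q₁ + p₂ q₂`. -/
def koszulOddEven (p q : Fin 3 → R) : Matrix (Fin 4) (Fin 4) R :=
  !![p 0, p 1, p 2, 0; q 1, -q 0, 0, p 2; q 2, 0, -q 0, -p 1; 0, q 2, -q 1, p 0]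

/-- The component from even to odd of the Koszul matrix of `p₀ q₀ + p₁ q₁ + p₂ q₂`. -/
def koszulEvenOdd (p q : Fin 3 → R) : Matrix (Fin 4) (Fin 4) R :=
  !![q 0, p 1, p 2, 0; q 1, -p 0, 0, p 2; q 2, 0, -p 0, -p 1; 0, q 2, -q 1, q 0]

/-- The Koszul matrix factorization of `p₀ q₀ + p₁ q₁ + p₂ q₂`. -/
def koszul (p q : Fin 3 → R) : Matrix (Fin 4 ⊕ Fin 4) (Fin 4 ⊕ Fin 4) R :=
  Matrix.fromBlocks 0 (koszulOddEven p q) (koszulEvenOdd p q) 0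

theorem koszulOddEven_mul_koszulEvenOdd (p q : Fin 3 → R) :
    koszulOddEven p q * koszulEvenOdd p q =
      (p 0 * q 0 + p 1 * q 1 + p 2 * q 2) • (1 : Matrix (Fin 4) (Fin 4) R) := by
  ext i j
  fin_cases i <;> fin_cases j <;>
    simp [koszulOddEven, koszulEvenOdd, Matrix.mul_apply, Fin.sum_univ_four] <;> ring

theorem koszulEvenOdd_mul_koszulOddEven (p q : Fin 3 → R) :
    koszulEvenOdd p q * koszulOddEven p q =
      (p 0 * q 0 + p 1 * q 1 + p 2 * q 2) • (1 : Matrix (Fin 4) (Fin 4) R) := by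
  ext i j
  fin_cases i <;> fin_cases j <;>
    simp [koszulOddEven, koszulEvenOdd, Matrix.mul_apply, Fin.sum_univ_four] <;> ring

/-- Take the even basis 1, e₀₁, e₀₂, e₁₂ and the odd basis e₀, e₁, e₂, e₀₁₂ of an exterior algebra.
The matrix is wedging on the right with `∑ qᵢeᵢ` plus contraction on the right with `p`. Each of the
two operations squares to zero, and their anticommutator is `∑ pᵢqᵢ`. -/
theorem koszul_mul_self (p q : Fin 3 → R) :
    koszul p q * koszul p q =
      (p 0 * q 0 + p 1 * q 1 + p 2 * q 2) •
        (1 : Matrix (Fin 4 ⊕ Fin 4) (Fin 4 ⊕ Fin 4) R) := by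
  rw [koszul, Matrix.fromBlocks_multiply, koszulOddEven_mul_koszulEvenOdd,
    koszulEvenOdd_mul_koszulOddEven, ← Matrix.fromBlocks_one, Matrix.fromBlocks_smul]
  simp

/-- Every entry is 0 or plus or minus a single factor, so additivity of `f` suffices. This covers
partial derivatives, which are not ring homomorphisms. -/
theorem koszul_map (f : R →+ S) (p q : Fin 3 → R) :
    (koszul p q).map f = koszul (fun i => f (p i)) fun i => f (q i) := by
  ext i j
  rcases i with i | i <;> rcases j with j | j <;> fin_cases i <;> fin_cases j <;>
    simp [koszul, koszulOddEven, koszulEvenOdd]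

theorem supertrace_fromBlocks {m n : ℕ} (A : Matrix (Fin m) (Fin m) R)
    (B : Matrix (Fin m) (Fin n) R) (C : Matrix (Fin n) (Fin m) R) (D : Matrix (Fin n) (Fin n) R) :
    supertrace (Matrix.fromBlocks A B C D) = A.trace - D.trace := rfl

/-- The supertrace of a product of six Koszul matrices: the determinant of the coefficients. -/
theorem supertrace_koszul_six (α β γ δ ε ζ η θ κ : R) :
    supertrace (koszul ![1, 0, 0] ![α, 0, 0] * (koszul ![0, 0, 1] ![0, 0, β] *
      koszul ![0, δ, 0] ![γ, -δ, 0]) * (koszul ![ε, η, 0] ![ζ, θ, 0] *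
      (koszul ![0, 0, 1] ![0, 0, κ] * koszul ![0, 1, 0] ![0, 1, 0]))) =
      (β - κ) * (γ * (θ - η) + 2 * δ * ζ - 2 * α * δ * ε) := by
  simp only [koszul, Matrix.fromBlocks_multiply, zero_mul, mul_zero, add_zero, zero_add,
    supertrace_fromBlocks]
  simp [koszulOddEven, koszulEvenOdd, Matrix.trace, Fin.sum_univ_four,
    Matrix.vecHead, Matrix.vecTail]
  ring

end Koszul

/-! ### Jacobian rings -/

section Jacobian

variable {k : Type*} [Field k]

/-- The variables become nilpotent in the quotient, hence integral over `k`. A finitely generated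
integral algebra is finite. -/
theorem jacobian_finite_of_pow_mem {n : ℕ} {f : MvPolynomial (Fin n) k} (e : Fin n → ℕ)
    (he : ∀ i, 0 < e i) (h : ∀ i, X i ^ e i ∈ jacobianIdeal f) :
    Module.Finite k (MvPolynomial (Fin n) k ⧸ jacobianIdeal f) := by
  have hint : Algebra.IsIntegral k (MvPolynomial (Fin n) k ⧸ jacobianIdeal f) := by
    refine ⟨fun y => ?_⟩
    obtain ⟨p, rfl⟩ := Ideal.Quotient.mk_surjective y
    induction p using MvPolynomial.induction_on with
    | C a => exact isIntegral_algebraMap (R := k) (x := a)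
    | add p q hp hq => rw [map_add]; exact hp.add hq
    | mul_X p i hp =>
      rw [map_mul]
      refine hp.mul (IsIntegral.of_pow (he i) ?_)
      rw [← map_pow, Ideal.Quotient.eq_zero_iff_mem.2 (h i)]
      exact isIntegral_zero
  exact Algebra.IsIntegral.finite

/-- The origin is a critical point, so evaluation there kills the Jacobian ideal but not 1. -/
theorem jacobian_nontrivial_of_eval_zero {n : ℕ} {f : MvPolynomial (Fin n) k}
    (h : ∀ i, constantCoeff (pderiv i f) = 0) :
    Nontrivial (MvPolynomial (Fin n) k ⧸ jacobianIdeal f) := by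
  refine Ideal.Quotient.nontrivial_iff.2 fun htop => ?_
  have hle : jacobianIdeal f ≤ RingHom.ker (constantCoeff : MvPolynomial (Fin n) k →+* k) := by
    rw [jacobianIdeal, Ideal.span_le]
    rintro _ ⟨i, rfl⟩
    exact h i
  have h1 : (1 : MvPolynomial (Fin n) k) ∈ jacobianIdeal f := htop ▸ Submodule.mem_top
  simpa using hle h1

/-- The matrix that computes residues thus also witnesses finiteness of the Jacobian ring. -/
theorem IsTransform.pow_mem {n : ℕ} {f : MvPolynomial (Fin n) k} {e : Fin n → ℕ}
    {M : Matrix (Fin n) (Fin n) (MvPolynomial (Fin n) k)}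
    (h : IsTransform (fun i => pderiv i f) e M) (i : Fin n) : X i ^ e i ∈ jacobianIdeal f := by
  rw [← congrFun h.2 i]
  have hj : ∀ j, pderiv j f ∈ jacobianIdeal f := fun j => Ideal.subset_span ⟨j, rfl⟩
  rw [Matrix.mulVec, dotProduct]
  exact Ideal.sum_mem _ fun j _ => Ideal.mul_mem_left _ (M i j) (hj j)

theorem isWeightedHomogeneous_C_mul {σ : Type*} {w : σ → ℚ} {p : MvPolynomial σ k} {D : ℚ}
    (c : k) (hp : IsWeightedHomogeneous w p D) : IsWeightedHomogeneous w (C c * p) D := by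
  simpa using (isWeightedHomogeneous_C w c).mul hp

theorem isWeightedHomogeneous_X_pow {σ : Type*} (w : σ → ℚ) (i : σ) (n : ℕ) :
    IsWeightedHomogeneous w (X i ^ n : MvPolynomial σ k) (n * w i) := by
  simpa using (isWeightedHomogeneous_X k w i).pow n

theorem IsWeightedHomogeneous.sub {σ : Type*} {w : σ → ℚ} {p q : MvPolynomial σ k} {D : ℚ}
    (hp : IsWeightedHomogeneous w p D) (hq : IsWeightedHomogeneous w q D) :
    IsWeightedHomogeneous w (p - q) D := by
  exact (weightedHomogeneousSubmodule k w D).sub_mem hp hq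

theorem IsWeightedHomogeneous.neg {σ : Type*} {w : σ → ℚ} {p : MvPolynomial σ k} {D : ℚ}
    (hp : IsWeightedHomogeneous w p D) : IsWeightedHomogeneous w (-p) D := by
  exact (weightedHomogeneousSubmodule k w D).neg_mem hp

end Jacobian

/-! ### Residues of the two potentials -/

section Transform

variable (k : Type*) [Field k]

theorem weightQ18_apply : weightQ18 0 = 1 / 4 ∧ weightQ18 1 = 2 / 3 ∧ weightQ18 2 = 7 / 8 :=
  ⟨rfl, rfl, rfl⟩

theorem weightE30_apply : weightE30 0 = 1 / 8 ∧ weightE30 1 = 2 / 3 ∧ weightE30 2 = 1 :=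
  ⟨rfl, rfl, rfl⟩

theorem pderiv_fQ18 : (fun i => pderiv i (fQ18 k)) =
    ![8 * X 0 ^ 7 + X 2 ^ 2, 3 * X 1 ^ 2, 2 * X 0 * X 2] := by
  funext i
  fin_cases i <;> simp [fQ18, pderiv_X]
  all_goals ring

theorem pderiv_fE30 : (fun i => pderiv i (fE30 k)) =
    ![8 * X 0 ^ 7 * X 2, -(3 * X 1 ^ 2), X 0 ^ 8 - 2 * X 2] := by
  funext i
  fin_cases i <;> simp [fE30, pderiv_X]
  all_goals ring

/-- Exponents of powers of the variables lying in the Jacobian ideal of `fQ18`. -/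
def expQ18 : Fin 3 → ℕ := ![8, 2, 3]

/-- Exponents of powers of the variables lying in the Jacobian ideal of `fE30`. -/
def expE30 : Fin 3 → ℕ := ![15, 2, 2]

/-- A matrix expressing powers of the variables by the partial derivatives of `fQ18`. -/
noncomputable def matQ18 : Matrix (Fin 3) (Fin 3) (MvPolynomial (Fin 3) k) :=
  !![C (1 / 8) * X 0, 0, -(C (1 / 16) * X 2); 0, C (1 / 3), 0; X 2, 0, -(4 * X 0 ^ 6)]

/-- A matrix expressing powers of the variables by the partial derivatives of `fE30`. -/
noncomputable def matE30 : Matrix (Fin 3) (Fin 3) (MvPolynomial (Fin 3) k) :=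
  !![C (1 / 4), 0, X 0 ^ 7; 0, -C (1 / 3), 0; C (1 / 16) * X 0, 0, -(C (1 / 2) * X 2)]

variable [CharZero k]

/-- The constants `C (1 / n)` are atoms for `ring`; these relations are what `linear_combination`
needs to cancel them. -/
theorem C_one_div_mul {σ : Type*} (n : ℕ) [n.AtLeastTwo] :
    C (1 / (OfNat.ofNat n : k)) * (OfNat.ofNat n : MvPolynomial σ k) = 1 := by
  rw [← map_ofNat (C : k →+* MvPolynomial σ k) n, ← C_mul, one_div,
    inv_mul_cancel₀ (OfNat.ofNat_ne_zero n), C_1]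

/-- The relations are `x·∂ₓf - (z/2)·∂_z f = 8x⁸`, where `xz²` cancels, and `z·∂ₓf - 4x⁶·∂_z f =
z³`. -/
theorem isTransform_matQ18 : IsTransform (fun i => pderiv i (fQ18 k)) expQ18 (matQ18 k) := by
  have h8 := C_one_div_mul k (σ := Fin 3) 8
  have h16 := C_one_div_mul k (σ := Fin 3) 16
  have h3 := C_one_div_mul k (σ := Fin 3) 3
  have h : 2 * C (1 / 16) = (C (1 / 8) : MvPolynomial (Fin 3) k) := by
    linear_combination C (1 / 8) * h16 - 2 * C (1 / 16) * h8
  refine ⟨fun i => by fin_cases i <;> decide, ?_⟩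
  rw [pderiv_fQ18]
  funext i
  fin_cases i <;>
    simp only [matQ18, expQ18, Matrix.mulVec, dotProduct, Fin.sum_univ_three, Matrix.of_apply,
      Matrix.cons_val, Fin.zero_eta, Fin.mk_one, Fin.reduceFinMk]
  · linear_combination X 0 ^ 8 * h8 - X 0 * X 2 ^ 2 * h
  · linear_combination X 1 ^ 2 * h3
  · ring

/-- Here `∂_w f = u⁸ - 2w` lets `w` be traded for `u⁸/2`: adding `u⁷·∂_w f` to `∂_u f / 4` leaves
`u¹⁵`. -/
theorem isTransform_matE30 : IsTransform (fun i => pderiv i (fE30 k)) expE30 (matE30 k) := by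
  have h2 := C_one_div_mul k (σ := Fin 3) 2
  have h4 := C_one_div_mul k (σ := Fin 3) 4
  have h16 := C_one_div_mul k (σ := Fin 3) 16
  have h3 := C_one_div_mul k (σ := Fin 3) 3
  have h : 8 * C (1 / 16) = (C (1 / 2) : MvPolynomial (Fin 3) k) := by
    linear_combination -8 * C (1 / 16) * h2 + C (1 / 2) * h16
  refine ⟨fun i => by fin_cases i <;> decide, ?_⟩
  rw [pderiv_fE30]
  funext i
  fin_cases i <;>
    simp only [matE30, expE30, Matrix.mulVec, dotProduct, Fin.sum_univ_three, Matrix.of_apply,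
      Matrix.cons_val, Fin.zero_eta, Fin.mk_one, Fin.reduceFinMk]
  · linear_combination 2 * X 0 ^ 7 * X 2 * h4
  · linear_combination X 1 ^ 2 * h3
  · linear_combination X 2 ^ 2 * h2 + X 0 ^ 8 * X 2 * h

theorem det_matQ18 : (matQ18 k).det = C (-1 / 6) * X 0 ^ 7 + C (1 / 48) * X 2 ^ 2 := by
  have h1 : C (1 / 8) * C (1 / 3) * 4 = (C (1 / 6) : MvPolynomial (Fin 3) k) := by
    rw [← map_ofNat (C : k →+* MvPolynomial (Fin 3) k) 4, ← C_mul, ← C_mul]; norm_num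
  have h2 : C (1 / 16) * C (1 / 3) = (C (1 / 48) : MvPolynomial (Fin 3) k) := by
    rw [← C_mul]; norm_num
  rw [Matrix.det_fin_three, neg_div, C_neg, ← h1, ← h2]
  simp only [matQ18, Matrix.of_apply, Matrix.cons_val]
  ring

theorem det_matE30 : (matE30 k).det = C (1 / 24) * X 2 + C (1 / 48) * X 0 ^ 8 := by
  have h1 : C (1 / 4) * C (1 / 3) * C (1 / 2) = (C (1 / 24) : MvPolynomial (Fin 3) k) := by
    rw [← C_mul, ← C_mul]; norm_num
  have h2 : C (1 / 16) * C (1 / 3) = (C (1 / 48) : MvPolynomial (Fin 3) k) := by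
    rw [← C_mul]; norm_num
  rw [Matrix.det_fin_three, ← h1, ← h2]
  simp only [matE30, Matrix.of_apply, Matrix.cons_val]
  ring

theorem isPotential_fQ18 : IsPotential weightQ18 (fQ18 k) where
  weight_pos i := by fin_cases i <;> norm_num [weightQ18]
  quasiHomogeneous := by
    refine ⟨2, ((?_ : IsWeightedHomogeneous _ _ _).add ?_).add ?_⟩
    · convert isWeightedHomogeneous_X_pow weightQ18 0 8 using 1; norm_num [weightQ18_apply]
    · convert isWeightedHomogeneous_X_pow weightQ18 1 3 using 1; norm_num [weightQ18_apply]
    · convert (isWeightedHomogeneous_X k weightQ18 0).mul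
        (isWeightedHomogeneous_X_pow weightQ18 2 2) using 1
      norm_num [weightQ18_apply]
  jacobian_nontrivial := jacobian_nontrivial_of_eval_zero fun i => by
    rw [congrFun (pderiv_fQ18 k) i]; fin_cases i <;> simp
  jacobian_finite := jacobian_finite_of_pow_mem _ (isTransform_matQ18 k).1 (isTransform_matQ18 k).pow_mem

theorem isPotential_fE30 : IsPotential weightE30 (fE30 k) where
  weight_pos i := by fin_cases i <;> norm_num [weightE30]
  quasiHomogeneous := by
    refine ⟨2, IsWeightedHomogeneous.sub (IsWeightedHomogeneous.sub ?_ ?_) ?_⟩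
    · convert (isWeightedHomogeneous_X_pow weightE30 0 8).mul
        (isWeightedHomogeneous_X k weightE30 2) using 1
      norm_num [weightE30_apply]
    · convert isWeightedHomogeneous_X_pow weightE30 1 3 using 1; norm_num [weightE30_apply]
    · convert isWeightedHomogeneous_X_pow weightE30 2 2 using 1; norm_num [weightE30_apply]
  jacobian_nontrivial := jacobian_nontrivial_of_eval_zero fun i => by
    rw [congrFun (pderiv_fE30 k) i]; fin_cases i <;> simp
  jacobian_finite := jacobian_finite_of_pow_mem _ (isTransform_matE30 k).1 (isTransform_matE30 k).pow_mem

end Transform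

/-! ### Coefficient extraction for the two residues. -/

section TopCoeff

variable {A : Type*} [CommRing A]

theorem topCoeff_sub {σ : Type*} [Fintype σ] (e : σ → ℕ) (p q : MvPolynomial σ A) :
    topCoeff e (p - q) = topCoeff e p - topCoeff e q := coeff_sub _ _ _ _

theorem topCoeff_add {σ : Type*} [Fintype σ] (e : σ → ℕ) (p q : MvPolynomial σ A) :
    topCoeff e (p + q) = topCoeff e p + topCoeff e q := coeff_add _ _ _

theorem topCoeff_monomial (e : Fin 3 → ℕ) (c : A) (i j l : ℕ) :
    topCoeff e (C c * (X 0 ^ i * X 1 ^ j * X 2 ^ l)) =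
      if i = e 0 - 1 ∧ j = e 1 - 1 ∧ l = e 2 - 1 then c else 0 := by
  have h : (X 0 ^ i * X 1 ^ j * X 2 ^ l : MvPolynomial (Fin 3) A) =
      monomial (Finsupp.single 0 i + Finsupp.single 1 j + Finsupp.single 2 l) 1 := by
    simp [X_pow_eq_monomial, monomial_mul]
  rw [h, C_mul_monomial, mul_one, topCoeff, coeff_monomial]
  congr 1
  simp [Finsupp.ext_iff, Fin.forall_fin_succ]

/-- The target monomial is `x⁷yz²`. The powers of `x` in the sum stop at 6, so multiplying them by
`z²` misses `x⁷`, and multiplying them by `x⁷` leaves no `z`. Only `y · z² · x⁷` contributes. -/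
theorem topCoeff_expQ18 (c v r r' : A) (s : ℕ → A) :
    topCoeff expQ18 (C c * (X 1 - C v) * (X 2 ^ 2 - ∑ j ∈ Finset.range 7, C (s j) * X 0 ^ (6 - j)) *
      (C r * X 0 ^ 7 + C r' * X 2 ^ 2)) = c * r := by
  have h : (C c * (X 1 - C v) * (X 2 ^ 2 - ∑ j ∈ Finset.range 7, C (s j) * X 0 ^ (6 - j)) *
      (C r * X 0 ^ 7 + C r' * X 2 ^ 2) : MvPolynomial (Fin 3) A) =
      C (c * r) * (X 0 ^ 7 * X 1 ^ 1 * X 2 ^ 2) + C (c * r') * (X 0 ^ 0 * X 1 ^ 1 * X 2 ^ 4)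
      - C (c * v * r) * (X 0 ^ 7 * X 1 ^ 0 * X 2 ^ 2)
      - C (c * v * r') * (X 0 ^ 0 * X 1 ^ 0 * X 2 ^ 4)
      - ∑ j ∈ Finset.range 7, (C (c * r * s j) * (X 0 ^ (13 - j) * X 1 ^ 1 * X 2 ^ 0)
        + C (c * r' * s j) * (X 0 ^ (6 - j) * X 1 ^ 1 * X 2 ^ 2)
        - C (c * v * r * s j) * (X 0 ^ (13 - j) * X 1 ^ 0 * X 2 ^ 0)
        - C (c * v * r' * s j) * (X 0 ^ (6 - j) * X 1 ^ 0 * X 2 ^ 2)) := by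
    simp only [Finset.sum_range_succ, Finset.sum_range_zero, C_mul]
    ring
  rw [h]
  simp only [Finset.sum_range_succ, Finset.sum_range_zero, zero_add, topCoeff_sub, topCoeff_add,
    topCoeff_monomial]
  simp [expQ18]

/-- The target monomial is `u¹⁴vw`. The factor `w` can only come from the determinant and `v` from
the linear factor, so `u¹⁴` must be the last term `j = 6` of the sum. -/
theorem topCoeff_expE30 (c y z r r' : A) (s : ℕ → A) :
    topCoeff expE30 (C c * (C y - X 1) * (C z - ∑ j ∈ Finset.range 7, C (s j) * X 0 ^ (2 * j + 2)) *
      (C r * X 2 + C r' * X 0 ^ 8)) = c * r * s 6 := by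
  have h : (C c * (C y - X 1) * (C z - ∑ j ∈ Finset.range 7, C (s j) * X 0 ^ (2 * j + 2)) *
      (C r * X 2 + C r' * X 0 ^ 8) : MvPolynomial (Fin 3) A) =
      C (c * y * z * r) * (X 0 ^ 0 * X 1 ^ 0 * X 2 ^ 1)
      + C (c * y * z * r') * (X 0 ^ 8 * X 1 ^ 0 * X 2 ^ 0)
      - C (c * z * r) * (X 0 ^ 0 * X 1 ^ 1 * X 2 ^ 1)
      - C (c * z * r') * (X 0 ^ 8 * X 1 ^ 1 * X 2 ^ 0)
      - ∑ j ∈ Finset.range 7, (C (c * y * r * s j) * (X 0 ^ (2 * j + 2) * X 1 ^ 0 * X 2 ^ 1)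
        + C (c * y * r' * s j) * (X 0 ^ (2 * j + 10) * X 1 ^ 0 * X 2 ^ 0)
        - C (c * r * s j) * (X 0 ^ (2 * j + 2) * X 1 ^ 1 * X 2 ^ 1)
        - C (c * r' * s j) * (X 0 ^ (2 * j + 10) * X 1 ^ 1 * X 2 ^ 0)) := by
    simp only [Finset.sum_range_succ, Finset.sum_range_zero, C_mul]
    ring
  rw [h]
  simp only [Finset.sum_range_succ, Finset.sum_range_zero, zero_add, topCoeff_sub, topCoeff_add,
    topCoeff_monomial]
  simp [expE30]

end TopCoeff

/-! ### The matrix factorization -/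

section Factorization

variable {k : Type*} [Field k]

/-- The weights of the variables `x, y, z, u, v, w`. -/
abbrev weightSum : Fin 3 ⊕ Fin 3 → ℚ := Sum.elim weightQ18 weightE30

/-- The first Koszul factors `x + a²u²`, `w - a⁸u⁸ + auz`, `y + v`. -/
noncomputable def factorLeft (a : k) : Fin 3 → MvPolynomial (Fin 3 ⊕ Fin 3) k :=
  ![X (Sum.inl 0) + C (a ^ 2) * X (Sum.inr 0) ^ 2,
    X (Sum.inr 2) - C (a ^ 8) * X (Sum.inr 0) ^ 8 + C a * (X (Sum.inr 0) * X (Sum.inl 2)),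
    X (Sum.inl 1) + X (Sum.inr 1)]

/-- The second Koszul factors `z² + ∑ x^(7-j) (-a²u²)^j`, `w - a⁸u⁸ - auz`, `y² - yv + v²`. -/
noncomputable def factorRight (a : k) : Fin 3 → MvPolynomial (Fin 3 ⊕ Fin 3) k :=
  ![X (Sum.inl 2) ^ 2 + ∑ j ∈ Finset.range 8,
      C ((-a ^ 2) ^ j) * (X (Sum.inl 0) ^ (7 - j) * X (Sum.inr 0) ^ (2 * j)),
    X (Sum.inr 2) - C (a ^ 8) * X (Sum.inr 0) ^ 8 - C a * (X (Sum.inr 0) * X (Sum.inl 2)),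
    X (Sum.inl 1) ^ 2 - X (Sum.inl 1) * X (Sum.inr 1) + X (Sum.inr 1) ^ 2]

/-- With `t = -a²u²` the first product is `(x - t)z² + x⁸ - t⁸`. Its terms `a²u²z²` and `-a¹⁶u¹⁶`
cancel against the second product. -/
theorem sum_factorLeft_mul_factorRight {a : k} (ha : 2 * a ^ 8 = 1) :
    factorLeft a 0 * factorRight a 0 + factorLeft a 1 * factorRight a 1 +
      factorLeft a 2 * factorRight a 2 = difference (fQ18 k) (fE30 k) := by
  have hC : 2 * (C a : MvPolynomial (Fin 3 ⊕ Fin 3) k) ^ 8 = 1 := by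
    rw [← map_ofNat (C : k →+* MvPolynomial (Fin 3 ⊕ Fin 3) k) 2, ← C_pow, ← C_mul, ha, C_1]
  simp only [factorLeft, factorRight, Matrix.cons_val, difference, fQ18, fE30, map_add, map_sub,
    map_mul, map_pow, map_neg, rename_X, Finset.sum_range_succ, Finset.sum_range_zero]
  -- Only the cross term `-2a⁸u⁸w` remains to be matched with `-u⁸w`.
  linear_combination (-X (Sum.inr 0) ^ 8 * X (Sum.inr 2)) * hC

theorem homogeneous_factorLeft (a : k) (i : Fin 3) :
    IsWeightedHomogeneous weightSum (factorLeft a i) (![1 / 4, 1, 2 / 3] i) := by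
  have hX := fun i => isWeightedHomogeneous_X k weightSum i
  have hXp := fun i n => isWeightedHomogeneous_X_pow (k := k) weightSum i n
  fin_cases i
  · refine IsWeightedHomogeneous.add ?_ (isWeightedHomogeneous_C_mul _ ?_)
    · exact hX (Sum.inl 0)
    · convert hXp (Sum.inr 0) 2 using 1
      norm_num [weightE30_apply]
  · refine IsWeightedHomogeneous.add (IsWeightedHomogeneous.sub ?_
      (isWeightedHomogeneous_C_mul _ ?_)) (isWeightedHomogeneous_C_mul _ ?_)
    · exact hX (Sum.inr 2)
    · convert hXp (Sum.inr 0) 8 using 1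
      norm_num [weightE30_apply]
    · convert (hX (Sum.inr 0)).mul (hX (Sum.inl 2)) using 1
      norm_num [weightE30_apply, weightQ18_apply]
  · refine IsWeightedHomogeneous.add ?_ ?_
    · exact hX (Sum.inl 1)
    · exact hX (Sum.inr 1)

theorem homogeneous_factorRight (a : k) (i : Fin 3) :
    IsWeightedHomogeneous weightSum (factorRight a i) (![7 / 4, 1, 4 / 3] i) := by
  have hX := fun i => isWeightedHomogeneous_X k weightSum i
  have hXp := fun i n => isWeightedHomogeneous_X_pow (k := k) weightSum i n
  fin_cases i
  · refine IsWeightedHomogeneous.add ?_ (IsWeightedHomogeneous.sum _ _ _ fun j hj =>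
      isWeightedHomogeneous_C_mul _ ?_)
    · convert hXp (Sum.inl 2) 2 using 1
      norm_num [weightQ18_apply]
    · have hj' : j ≤ 7 := Nat.lt_succ_iff.1 (Finset.mem_range.1 hj)
      convert (hXp (Sum.inl 0) (7 - j)).mul (hXp (Sum.inr 0) (2 * j)) using 1
      push_cast [Nat.cast_sub hj']
      simp [weightE30_apply, weightQ18_apply]
      ring
  · refine IsWeightedHomogeneous.sub (IsWeightedHomogeneous.sub ?_
      (isWeightedHomogeneous_C_mul _ ?_)) (isWeightedHomogeneous_C_mul _ ?_)
    · exact hX (Sum.inr 2)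
    · convert hXp (Sum.inr 0) 8 using 1
      norm_num [weightE30_apply]
    · convert (hX (Sum.inr 0)).mul (hX (Sum.inl 2)) using 1
      norm_num [weightE30_apply, weightQ18_apply]
  · refine IsWeightedHomogeneous.add (IsWeightedHomogeneous.sub ?_ ?_) ?_
    · convert hXp (Sum.inl 1) 2 using 1
      norm_num [weightQ18_apply]
    · convert (hX (Sum.inl 1)).mul (hX (Sum.inr 1)) using 1
      norm_num [weightE30_apply, weightQ18_apply]
    · convert hXp (Sum.inr 1) 2 using 1
      norm_num [weightE30_apply]

/-- Degrees of the basis vectors. -/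
def basisDegree : Fin 4 ⊕ Fin 4 → ℚ :=
  Sum.elim ![0, -3 / 4, -13 / 12, -1 / 3] ![-3 / 4, 0, -1 / 3, -13 / 12]

/-- The exterior basis vector indexed by a subset has as degree the sum of `deg pᵢ - 1` over that
subset. Since `deg pᵢ + deg qᵢ = 2`, wedging and contraction are then both of degree 1. -/
theorem homogeneous_koszul {σ : Type*} {w : σ → ℚ} {p q : Fin 3 → MvPolynomial σ k}
    (hp : ∀ i, IsWeightedHomogeneous w (p i) (![1 / 4, 1, 2 / 3] i))
    (hq : ∀ i, IsWeightedHomogeneous w (q i) (![7 / 4, 1, 4 / 3] i)) (i j : Fin 4 ⊕ Fin 4) :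
    IsWeightedHomogeneous w (koszul p q i j) (basisDegree j - basisDegree i + 1) := by
  have hp2 : IsWeightedHomogeneous w (p 2) (2 / 3) := hp 2
  have hq2 : IsWeightedHomogeneous w (q 2) (4 / 3) := hq 2
  have h0 : ∀ D : ℚ, IsWeightedHomogeneous w (0 : MvPolynomial σ k) D :=
    isWeightedHomogeneous_zero k w
  have of_eq : ∀ {r : MvPolynomial σ k} {D D' : ℚ}, IsWeightedHomogeneous w r D → D = D' →
      IsWeightedHomogeneous w r D' := fun h e => e ▸ h
  have neg : ∀ {r : MvPolynomial σ k} {D : ℚ}, IsWeightedHomogeneous w r D →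
      IsWeightedHomogeneous w (-r) D := fun h => IsWeightedHomogeneous.neg h
  rcases i with i | i <;> rcases j with j | j
  · exact h0 _
  iterate 2
    · fin_cases i <;> fin_cases j <;> first
        | exact h0 _
        | exact of_eq (hp 0) (by norm_num [basisDegree])
        | exact of_eq (hp 1) (by norm_num [basisDegree])
        | exact of_eq hp2 (by norm_num [basisDegree])
        | exact of_eq (hq 0) (by norm_num [basisDegree])
        | exact of_eq (hq 1) (by norm_num [basisDegree])
        | exact of_eq hq2 (by norm_num [basisDegree])
        | exact of_eq (neg (hp 0)) (by norm_num [basisDegree])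
        | exact of_eq (neg (hp 1)) (by norm_num [basisDegree])
        | exact of_eq (neg (hq 0)) (by norm_num [basisDegree])
        | exact of_eq (neg (hq 1)) (by norm_num [basisDegree])
  · exact h0 _

/-- The Koszul matrix factorization of `x⁸ + y³ + xz² - u⁸w + v³ + w²`. -/
noncomputable def factorization {a : k} (ha : 2 * a ^ 8 = 1) :
    MatrixFactorization weightSum (difference (fQ18 k) (fE30 k)) where
  evenRank := 4
  oddRank := 4
  genDeg := basisDegree
  d := koszul (factorLeft a) (factorRight a)
  degree := 1
  even_even _ _ := rfl
  odd_odd _ _ := rfl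
  homogeneous :=
    homogeneous_koszul (homogeneous_factorLeft a) (homogeneous_factorRight a)
  sq := by rw [koszul_mul_self, sum_factorLeft_mul_factorRight ha]

end Factorization

/-! ### Quantum dimensions -/

section QuantumDimension

variable {k : Type*} [Field k]

theorem koszul_map_pderiv {σ : Type*} (i : σ) (p q : Fin 3 → MvPolynomial σ k) :
    (koszul p q).map (pderiv i) = koszul (fun j => pderiv i (p j)) fun j => pderiv i (q j) :=
  koszul_map (pderiv i).toLinearMap.toAddMonoidHom p q

theorem pderiv_x_koszul (a : k) :
    (koszul (factorLeft a) (factorRight a)).map (pderiv (Sum.inl 0)) =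
      -- The term `j = 7` of the second factor is free of `x` and drops out.
      koszul ![1, 0, 0] ![∑ j ∈ Finset.range 7, C (((7 - j : ℕ) : k) * (-a ^ 2) ^ j) *
        (X (Sum.inl 0) ^ (6 - j) * X (Sum.inr 0) ^ (2 * j)), 0, 0] := by
  rw [koszul_map_pderiv]
  congr 1 <;> funext i <;> fin_cases i <;>
    simp [factorLeft, factorRight, pderiv_X, Finset.sum_range_succ]
  all_goals ring

theorem pderiv_y_koszul (a : k) :
    (koszul (factorLeft a) (factorRight a)).map (pderiv (Sum.inl 1)) =
      koszul ![0, 0, 1] ![0, 0, 2 * X (Sum.inl 1) - X (Sum.inr 1)] := by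
  rw [koszul_map_pderiv]
  congr 1 <;> funext i <;> fin_cases i <;>
    simp [factorLeft, factorRight, pderiv_X, Finset.sum_range_succ]

theorem pderiv_z_koszul (a : k) :
    (koszul (factorLeft a) (factorRight a)).map (pderiv (Sum.inl 2)) =
      koszul ![0, C a * X (Sum.inr 0), 0] ![2 * X (Sum.inl 2), -(C a * X (Sum.inr 0)), 0] := by
  rw [koszul_map_pderiv]
  congr 1 <;> funext i <;> fin_cases i <;>
    simp [factorLeft, factorRight, pderiv_X, Finset.sum_range_succ]

/-- The term `j = 0` of the sum is free of `u`. Shifting the index by one aligns the powers of `x`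
with those in `pderiv_x_koszul`. -/
theorem pderiv_u_koszul (a : k) :
    (koszul (factorLeft a) (factorRight a)).map (pderiv (Sum.inr 0)) =
      koszul ![2 * C (a ^ 2) * X (Sum.inr 0),
        C a * X (Sum.inl 2) - 8 * C (a ^ 8) * X (Sum.inr 0) ^ 7, 0]
      ![∑ j ∈ Finset.range 7, C (((2 * j + 2 : ℕ) : k) * (-a ^ 2) ^ (j + 1)) *
        (X (Sum.inl 0) ^ (6 - j) * X (Sum.inr 0) ^ (2 * j + 1)),
        -(C a * X (Sum.inl 2)) - 8 * C (a ^ 8) * X (Sum.inr 0) ^ 7, 0] := by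
  have h2 : (C 2 : MvPolynomial (Fin 3 ⊕ Fin 3) k) = 2 := map_ofNat C 2
  rw [koszul_map_pderiv]
  congr 1 <;> funext i <;> fin_cases i <;>
    simp [factorLeft, factorRight, pderiv_X, Finset.sum_range_succ, h2]
  all_goals ring

theorem pderiv_v_koszul (a : k) :
    (koszul (factorLeft a) (factorRight a)).map (pderiv (Sum.inr 1)) =
      koszul ![0, 0, 1] ![0, 0, 2 * X (Sum.inr 1) - X (Sum.inl 1)] := by
  rw [koszul_map_pderiv]
  congr 1 <;> funext i <;> fin_cases i <;>
    simp [factorLeft, factorRight, pderiv_X, Finset.sum_range_succ]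
  all_goals ring

theorem pderiv_w_koszul (a : k) :
    (koszul (factorLeft a) (factorRight a)).map (pderiv (Sum.inr 2)) =
      koszul ![0, 1, 0] ![0, 1, 0] := by
  rw [koszul_map_pderiv]
  congr 1 <;> funext i <;> fin_cases i <;>
    simp [factorLeft, factorRight, pderiv_X, Finset.sum_range_succ]

/-- The `y` and `v` derivatives contribute `(2y - v) - (2v - y) = 3(y - v)`. In the other factor the
`u⁷` terms cancel, and the two sums combine with weights `(j + 1) + (7 - j) = 8`. -/
theorem qdimNumerator_factorization {a : k} (ha : 2 * a ^ 8 = 1) :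
    qdimNumerator (factorization ha) =
      C (-12 * a) * (X (Sum.inl 1) - X (Sum.inr 1)) * (X (Sum.inl 2) ^ 2 -
        ∑ j ∈ Finset.range 7, C (8 * (-a ^ 2) ^ (j + 1)) *
          (X (Sum.inl 0) ^ (6 - j) * X (Sum.inr 0) ^ (2 * j + 2))) := by
  have key := supertrace_koszul_six (R := MvPolynomial (Fin 3 ⊕ Fin 3) k)
  simp only [mul_assoc] at key
  -- Both list products unfold definitionally, each ending in a factor 1.
  have h : qdimNumerator (factorization ha) = supertrace
    (((koszul (factorLeft a) (factorRight a)).map (pderiv (Sum.inl 0)) *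
      ((koszul (factorLeft a) (factorRight a)).map (pderiv (Sum.inl 1)) *
      ((koszul (factorLeft a) (factorRight a)).map (pderiv (Sum.inl 2)) * 1))) *
    ((koszul (factorLeft a) (factorRight a)).map (pderiv (Sum.inr 0)) *
      ((koszul (factorLeft a) (factorRight a)).map (pderiv (Sum.inr 1)) *
      ((koszul (factorLeft a) (factorRight a)).map (pderiv (Sum.inr 2)) * 1)))) := rfl
  rw [h, pderiv_x_koszul, pderiv_y_koszul, pderiv_z_koszul, pderiv_u_koszul, pderiv_v_koszul,
    pderiv_w_koszul]
  simp only [mul_one, mul_assoc]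
  rw [key]
  simp only [Finset.sum_range_succ, Finset.sum_range_zero, map_mul, map_pow, map_neg, map_natCast,
    map_ofNat]
  push_cast
  ring

/-- The residues live over the polynomial ring in the other three variables, so matrices over `k`
are base changed along `C`. -/
theorem IsTransform.map {σ A B : Type*} [Fintype σ] [CommRing A] [CommRing B]
    {f : σ → MvPolynomial σ A} {e : σ → ℕ} {M : Matrix σ σ (MvPolynomial σ A)}
    (h : IsTransform f e M) (φ : A →+* B) :
    IsTransform (fun i => MvPolynomial.map φ (f i)) e (M.map (MvPolynomial.map φ)) := by
  refine ⟨h.1, funext fun i => ?_⟩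
  have hi := congrArg (MvPolynomial.map φ) (congrFun h.2 i)
  rw [RingHom.map_mulVec, map_pow, map_X] at hi
  exact hi

/-- The value is `(-12a)·(-1/6)`. -/
theorem leftQdim_factorization {a : k} [CharZero k] (ha : 2 * a ^ 8 = 1) :
    leftQdim (fQ18 k) (fE30 k) (factorization ha) = C (2 * a) := by
  have hnum : sumAlgEquiv k (Fin 3) (Fin 3) (qdimNumerator (factorization ha)) =
      C (C (-12 * a)) * (X 1 - C (X 1)) * (X 2 ^ 2 - ∑ j ∈ Finset.range 7,
        C (C (8 * (-a ^ 2) ^ (j + 1)) * X 0 ^ (2 * j + 2)) * X 0 ^ (6 - j)) := by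
    rw [qdimNumerator_factorization]
    simp only [map_mul, map_sub, map_sum, map_pow, sumAlgEquiv_X_inl, sumAlgEquiv_X_inr,
      sumAlgEquiv_C_inl, mul_assoc, mul_comm (X 0 ^ (6 - _) : MvPolynomial (Fin 3) _)]
  have hdet : ((matQ18 k).map (MvPolynomial.map C)).det =
      C (C (-1 / 6) : MvPolynomial (Fin 3) k) * X 0 ^ 7 + C (C (1 / 48)) * X 2 ^ 2 := by
    rw [← RingHom.mapMatrix_apply, ← RingHom.map_det, det_matQ18]
    simp only [map_add, map_mul, map_pow, map_X, map_C]
  rw [leftQdim, residue_eq ((isTransform_matQ18 k).map C), hnum, hdet, topCoeff_expQ18, ← C_mul]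
  congr 1
  ring

/-- The value is `(-12a)·(1/24)·8(-a²)⁷`. It is free of `x` because the contributing term `j = 6`
carries `x⁰`. -/
theorem rightQdim_factorization {a : k} [CharZero k] (ha : 2 * a ^ 8 = 1) :
    rightQdim (fQ18 k) (fE30 k) (factorization ha) = C (4 * a ^ 15) := by
  have hnum : sumAlgEquiv k (Fin 3) (Fin 3)
      (rename Sum.swap (qdimNumerator (factorization ha))) =
      C (C (-12 * a)) * (C (X 1) - X 1) * (C (X 2 ^ 2) - ∑ j ∈ Finset.range 7,
        C (C (8 * (-a ^ 2) ^ (j + 1)) * X 0 ^ (6 - j)) * X 0 ^ (2 * j + 2)) := by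
    rw [qdimNumerator_factorization]
    simp only [map_mul, map_sub, map_sum, map_pow, rename_X, rename_C, Sum.swap_inl, Sum.swap_inr,
      sumAlgEquiv_X_inl, sumAlgEquiv_X_inr, sumAlgEquiv_C_inl, mul_assoc]
  have hdet : ((matE30 k).map (MvPolynomial.map C)).det =
      C (C (1 / 24) : MvPolynomial (Fin 3) k) * X 2 + C (C (1 / 48)) * X 0 ^ 8 := by
    rw [← RingHom.mapMatrix_apply, ← RingHom.map_det, det_matE30]
    simp only [map_add, map_mul, map_pow, map_X, map_C]
  rw [rightQdim, residue_eq ((isTransform_matE30 k).map C), hnum, hdet, topCoeff_expE30,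
    Nat.sub_self, pow_zero, mul_one, ← C_mul, ← C_mul]
  congr 1
  ring

end QuantumDimension

end LandauGinzburg


theorem mainTheorem3 (k : Type*) [Field k] [IsAlgClosed k] [CharZero k] :
    LandauGinzburg.OrbifoldEquivalent
        LandauGinzburg.weightQ18 (LandauGinzburg.fQ18 k)
        LandauGinzburg.weightE30 (LandauGinzburg.fE30 k) ∧
      ∃ Q : LandauGinzburg.MatrixFactorization
          (Sum.elim LandauGinzburg.weightQ18 LandauGinzburg.weightE30)
          (LandauGinzburg.difference (LandauGinzburg.fQ18 k) (LandauGinzburg.fE30 k)),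
        Q.rank = 8 ∧
          LandauGinzburg.leftQdim (LandauGinzburg.fQ18 k) (LandauGinzburg.fE30 k) Q ≠ 0 ∧
          LandauGinzburg.rightQdim (LandauGinzburg.fQ18 k) (LandauGinzburg.fE30 k) Q ≠ 0 := by
  -- Algebraic closedness enters only through this eighth root of 1/2.
  obtain ⟨a, h⟩ := IsAlgClosed.exists_pow_nat_eq (1 / 2 : k) (n := 8) (by norm_num)
  have ha : 2 * a ^ 8 = 1 := by rw [h]; norm_num
  have ha0 : a ≠ 0 := by
    rintro rfl
    norm_num at ha
  have hl : LandauGinzburg.leftQdim (LandauGinzburg.fQ18 k) (LandauGinzburg.fE30 k)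
      (LandauGinzburg.factorization ha) ≠ 0 := by
    rw [LandauGinzburg.leftQdim_factorization, MvPolynomial.C_ne_zero]
    exact mul_ne_zero two_ne_zero ha0
  have hr : LandauGinzburg.rightQdim (LandauGinzburg.fQ18 k) (LandauGinzburg.fE30 k)
      (LandauGinzburg.factorization ha) ≠ 0 := by
    rw [LandauGinzburg.rightQdim_factorization, MvPolynomial.C_ne_zero]
    exact mul_ne_zero (by norm_num) (pow_ne_zero 15 ha0)
  exact ⟨⟨LandauGinzburg.isPotential_fQ18 k, LandauGinzburg.isPotential_fE30 k,
    LandauGinzburg.factorization ha, hl, hr⟩, LandauGinzburg.factorization ha, rfl, hl, hr⟩
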